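/- Let $a\ge 1$ and let $\vec p=(p_1,\dots,p_a)$ be real numbers with $p_j\ge 0$ and $p_1+\cdots+p_a=1$. For $n\ge 0$ let $P_{n,a,\vec p}$ be the law on $S_n$ of a biased $a$-shuffle: choose $(b_1,\dots,b_a)$ with $b_j\ge 0$ and $b_1+\cdots+b_a=n$ with probability $\binom{n}{b_1\,\cdots\,b_a}\prod_{j=1}^a p_j^{b_j}$, and then choose uniformly one of the permutations $\pi\in S_n$ such that $\pi^{-1}$ has descent set contained in $\{b_1,b_1+b_2,\dots,b_1+\cdots+b_a\}$ (position $i<n$ is a descent of $\sigma$ if $\sigma(i)>\sigma(i+1)$, and position $n$ is by convention always a descent). Let $E_{n,a,\vec p}$ be expectation with respect to $P_{n,a,\vec p}$, and let $N_i(\pi)$ be the number of $i$-cycles of $\pi$ (fixed points are $1$-cycles). For integers $r_1,\dots,r_a\ge 0$ with $m=r_1+\cdots+r_a\ge 1$ put \[ M(r_1,\dots,r_a)=\frac1m\sum_{d\mid m,r_1,\dots,r_a}\mu(d)\,\frac{(m/d)!}{(r_1/d)!\cdots(r_a/d)!}, \] where $\mu$ is the Möbius function. Then every $M(r_1,\dots,r_a)$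 is a nonnegative integer, and, as formal power series in $u$ with coefficients in $\mathbb R[x_1,x_2,\dots]$, \[ \sum_{n=0}^\infty u^n\,E_{n,a,\vec p}\Big[\prod_{i=1}^n x_i^{N_i}\Big]=\prod_{i=1}^\infty\ \prod_{\substack{r_1,\dots,r_a\ge 0\\ r_1+\cdots+r_a=i}}\left(\frac{1}{1-p_1^{r_1}\cdots p_a^{r_a}u^i x_i}\right)^{M(r_1,\dots,r_a)}, \] where the infinite product converges in the formal sense (unconditionally, each coefficient of $u^k$ being eventually constant). -/

import Mathlib

open scoped PowerSeries.WithPiTopology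

namespace BiasedShuffle

/-- The descent set of `π ∈ S_n`, with positions numbered `1, …, n`: position `i < n` is a descent
if `π(i) > π(i+1)`, and (by convention) position `n` is always a descent.
Since `Fin n` is numbered from `0`, the value `π(i)` is `π ⟨i - 1, _⟩`. -/
def descentSet {n : ℕ} (π : Equiv.Perm (Fin n)) : Set ℕ :=
  {i | 1 ≤ i ∧ (i = n ∨ ∃ h : i < n, π ⟨i, h⟩ < π ⟨i - 1, by omega⟩)}

/-- The set `{b_1, b_1 + b_2, …, b_1 + ⋯ + b_a}`. -/
def partialSums {a : ℕ} (b : Fin a → ℕ) : Set ℕ :=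
  Set.range fun i : Fin a => ∑ j ∈ Finset.Iic i, b j

open Classical in
/-- The permutations obtained by interleaving packets of sizes `b_1, …, b_a`: those whose inverse
has descent set contained in `{b_1, b_1 + b_2, …, b_1 + ⋯ + b_a}`. -/
noncomputable def interleavings (n : ℕ) {a : ℕ} (b : Fin a → ℕ) : Finset (Equiv.Perm (Fin n)) :=
  Finset.univ.filter fun π => descentSet π⁻¹ ⊆ partialSums b

/-- The mass that a biased `a`-shuffle with parameters `p` gives to `π ∈ S_n`: pick pile sizes
`b_1 + ⋯ + b_a = n` from the multinomial law, then pick uniformly one of the interleavings. -/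
noncomputable def shuffleMass (n : ℕ) {a : ℕ} (p : Fin a → ℝ) (π : Equiv.Perm (Fin n)) : ℝ :=
  ∑ b ∈ Finset.piAntidiag (Finset.univ : Finset (Fin a)) n,
    ((Nat.multinomial Finset.univ b : ℝ) * ∏ i, p i ^ b i) *
      (if π ∈ interleavings n b then ((interleavings n b).card : ℝ)⁻¹ else 0)

/-- Expectation of `f` under a biased `a`-shuffle of `n` cards; `f` may take values in any
real vector space. -/
noncomputable def shuffleExpect (n : ℕ) {a : ℕ} (p : Fin a → ℝ) {V : Type*} [AddCommMonoid V]
    [Module ℝ V] (f : Equiv.Perm (Fin n) → V) : V :=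
  ∑ π, shuffleMass n p π • f π

/-- The number of `i`-cycles of `π`; fixed points are the `1`-cycles. -/
def numCycles {n : ℕ} (i : ℕ) (π : Equiv.Perm (Fin n)) : ℕ :=
  π.partition.parts.count i

/-- `M(r_1, …, r_a) = (1/n) ∑ μ(d) (n/d)! / ((r_1/d)! ⋯ (r_a/d)!)`, where `n = r_1 + ⋯ + r_a` and
the sum runs over the common divisors `d` of `n, r_1, …, r_a`. -/
noncomputable def necklaceM {a : ℕ} (r : Fin a → ℕ) : ℚ :=
  1 / ((∑ i, r i : ℕ) : ℚ) *
    ∑ d ∈ (∑ i, r i).divisors.filter (fun d => ∀ i, d ∣ r i),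
      (ArithmeticFunction.moebius d : ℚ) *
        ((((∑ i, r i) / d).factorial : ℚ) / ∏ i, ((r i / d).factorial : ℚ))

/-- The generating function `∑_n u^n E_n ∏_{i=1}^n x_i^{N_i}`, a formal power series in `u` over
the polynomial ring `ℝ[x_1, x_2, …]` (the variable with index `0` is not used). -/
noncomputable def cycleGenFun {a : ℕ} (p : Fin a → ℝ) : PowerSeries (MvPolynomial ℕ ℝ) :=
  PowerSeries.mk fun n =>
    shuffleExpect n p fun π => ∏ i ∈ Finset.Icc 1 n, MvPolynomial.X i ^ numCycles i π

/-- The factor `1 / (1 - p_1^{r_1} ⋯ p_a^{r_a} u^i x_i)`. -/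
noncomputable def cycleFactor {a : ℕ} (p : Fin a → ℝ) (i : ℕ) (r : Fin a → ℕ) :
    PowerSeries (MvPolynomial ℕ ℝ) :=
  Ring.inverse (1 - PowerSeries.C (MvPolynomial.C (∏ j, p j ^ r j)) * PowerSeries.X ^ i *
    PowerSeries.C (MvPolynomial.X i))

end BiasedShuffle

/-! ### Shuffles as inverse sorting permutations of words. -/

namespace BiasedShuffle

open Finset

/-! Give a word of length `n` over `a` letters the product of the `p`-weights of its letters. The
shuffle is the inverse of its stable sorting permutation (`shuffleMass_eq_sum_words`), so the
expectation becomes a weighted sum over words, with the cycles of `Tuple.sort w`.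

The Gessel–Reutenauer correspondence sends `w` to the multiset of necklaces read along these cycles.
Stability makes each of them primitive, of the same length as its cycle (`minimalPeriod_cycleSeq`).
The infinite repetitions, in lexicographic order, are already listed in the order of the positions
(`cycleSeq_monotone`), so the multiset determines `w`, and every multiset of total length `n` arises
(`seqMult_injective`, `exists_seqMult_eq`). Letter weights and cycle counts are multiplicative over
necklaces, so each necklace contributes one geometric series (`coeff_cycleGenFun`).

Möbius inversion identifies `M(r)` with the number of primitive necklaces of content `r`
(`card_necklace_content_eq_necklaceM`). For the coefficient of `u ^ n` all necklaces are realised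
with common period `n!`; factors of index above `n` are invisible there. -/

/-- The number of occurrences of each letter in a finite word. -/
def content {a n : ℕ} (w : Fin n → Fin a) : Fin a → ℕ := fun c => #{i | w i = c}

theorem content_comp_perm {a n : ℕ} (w : Fin n → Fin a) (σ : Equiv.Perm (Fin n)) :
    content (w ∘ σ) = content w := by
  funext c
  exact card_bij (fun i _ => σ i) (by simp) (by simp) fun i hi => ⟨σ.symm i, by simpa using hi⟩

theorem sum_content {a n : ℕ} (w : Fin n → Fin a) : ∑ c, content w c = n := by
  simpa [content] using (card_eq_sum_card_fiberwise (s := (univ : Finset (Fin n)))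
    (t := univ) (f := w) (by simp)).symm

theorem content_mem_piAntidiag {a n : ℕ} (w : Fin n → Fin a) :
    content w ∈ piAntidiag (univ : Finset (Fin a)) n := by
  simp [sum_content]

theorem prod_letters {a n : ℕ} {R : Type*} [CommMonoid R] (p : Fin a → R) (w : Fin n → Fin a) :
    ∏ i, p (w i) = ∏ c, p c ^ content w c := by
  rw [← prod_fiberwise_of_maps_to (s := univ) (t := univ) (g := w) (by simp)]
  refine prod_congr rfl fun c _ => ?_
  rw [prod_congr rfl (g := fun _ => p c) (by simp +contextual), prod_const, content]

/-- The number of words with prescribed content is a multinomial coefficient. -/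
theorem card_content_eq {a n : ℕ} (b : Fin a → ℕ) (hb : ∑ c, b c = n) :
    #{w : Fin n → Fin a | content w = b} = Nat.multinomial univ b := by
  classical
  -- Compare the coefficient of the monomial with exponent `b` in two expansions of `(∑ X_c) ^ n`.
  have h1 := sum_pow_eq_sum_piAntidiag (univ : Finset (Fin a))
    (fun c => (MvPolynomial.X c : MvPolynomial (Fin a) ℕ)) n
  have h2 := sum_pow' (univ : Finset (Fin a))
    (fun c => (MvPolynomial.X c : MvPolynomial (Fin a) ℕ)) n
  have key : ∀ r : Fin a → ℕ, (∏ c, (MvPolynomial.X c : MvPolynomial (Fin a) ℕ) ^ r c) =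
      MvPolynomial.monomial (Finsupp.equivFunOnFinite.symm r) 1 := by
    intro r
    rw [MvPolynomial.monomial_eq, Finsupp.prod_fintype _ _ (by simp)]
    simp
  rw [h1] at h2
  simp only [prod_letters, key, ← nsmul_eq_mul] at h2
  have h3 := congrArg (MvPolynomial.coeff (Finsupp.equivFunOnFinite.symm b)) h2
  simp only [MvPolynomial.coeff_sum, MvPolynomial.coeff_smul, MvPolynomial.coeff_monomial,
    EmbeddingLike.apply_eq_iff_eq] at h3
  rw [card_filter]
  simpa [hb, eq_comm] using h3.symm

theorem eq_of_monotone_of_card_fiber_eq {n : ℕ} {α : Type*} [LinearOrder α] {f g : Fin n → α}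
    (hf : Monotone f) (hg : Monotone g)
    (h : ∀ x, #{i | f i = x} = #{i | g i = x}) : f = g := by
  apply List.ofFn_injective
  refine List.Perm.eq_of_pairwise' hf.sortedLE_ofFn.pairwise hg.sortedLE_ofFn.pairwise ?_
  rw [← Multiset.coe_eq_coe, ← Fin.univ_val_map, ← Fin.univ_val_map]
  ext x
  rw [Multiset.count_map, Multiset.count_map]
  simpa only [card_def, filter_val, eq_comm] using h x

/-- In a sorted word the letters `≤ c` fill an initial segment, whose length is a partial sum of the
content. -/
theorem apply_le_iff_lt_sum_content {a n : ℕ} {g : Fin n → Fin a} (hg : Monotone g) (i : Fin n)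
    (c : Fin a) : g i ≤ c ↔ (i : ℕ) < ∑ j ∈ Iic c, content g j := by
  rw [← Tuple.lt_card_le_iff_apply_le_of_monotone hg]
  have : #{i | g i ≤ c} = ∑ j ∈ Iic c, content g j := by
    rw [card_eq_sum_card_fiberwise (t := Iic c) (f := g) (by simp [Set.MapsTo])]
    refine sum_congr rfl fun j hj => congrArg card ?_
    ext i
    simp only [mem_Iic] at hj
    simp only [mem_filter, mem_univ, true_and, and_iff_right_iff_imp]
    rintro rfl
    exact hj
  rw [this]

theorem mem_partialSums_content_iff {a n : ℕ} {g : Fin n → Fin a} (hg : Monotone g) {i : ℕ}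
    (h1 : 1 ≤ i) (hi : i < n) :
    i ∈ partialSums (content g) ↔ g ⟨i - 1, by omega⟩ ≠ g ⟨i, hi⟩ := by
  have hle : g ⟨i - 1, by omega⟩ ≤ g ⟨i, hi⟩ := hg (by simp)
  constructor
  · rintro ⟨c, hc⟩ heq
    have h2 := apply_le_iff_lt_sum_content hg ⟨i - 1, by omega⟩ c
    have h3 := apply_le_iff_lt_sum_content hg ⟨i, hi⟩ c
    simp only at hc h2 h3
    rw [hc] at h2 h3
    rw [heq, h3] at h2
    omega
  · intro hne
    refine ⟨g ⟨i - 1, by omega⟩, ?_⟩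
    have h2 := apply_le_iff_lt_sum_content hg ⟨i - 1, by omega⟩ (g ⟨i - 1, by omega⟩)
    have h3 := apply_le_iff_lt_sum_content hg ⟨i, hi⟩ (g ⟨i - 1, by omega⟩)
    have h4 : ¬ g ⟨i, hi⟩ ≤ g ⟨i - 1, by omega⟩ := fun h => hne (le_antisymm hle h)
    simp only [le_refl, true_iff] at h2
    rw [h3] at h4
    simp only at h2 h4 ⊢
    omega

/-- Absorbs the convention that `n` is a descent; `1 ≤ n` makes the alphabet nonempty, so there is a
last partial sum. -/
theorem card_mem_partialSums_content {a n : ℕ} (w : Fin n → Fin a) (hn : 1 ≤ n) :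
    n ∈ partialSums (content w) := by
  obtain ⟨m, rfl⟩ : ∃ m, a = m + 1 := ⟨a - 1, by have := (w ⟨0, hn⟩).pos; omega⟩
  refine ⟨Fin.last m, ?_⟩
  have : Iic (Fin.last m) = univ := by ext; simp [Fin.le_last]
  simp only [this, sum_content]

/-- The descents of `σ` lie among the partial sums of the content of a sorted word `g` exactly
when `σ` is increasing on each block of equal letters of `g`. -/
theorem descentSet_subset_partialSums_iff {a n : ℕ} {g : Fin n → Fin a} (hg : Monotone g)
    (σ : Equiv.Perm (Fin n)) :
    descentSet σ ⊆ partialSums (content g) ↔ ∀ i j, i < j → g i = g j → σ i < σ j := by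
  constructor
  · intro h
    have step : ∀ (k : ℕ) (i : Fin n) (hk : i + (k + 1) < n), g i = g ⟨i + (k + 1), hk⟩ →
        σ i < σ ⟨i + (k + 1), hk⟩ := by
      intro k
      have succ : ∀ (i : ℕ) (hi : i + 1 < n), g ⟨i, by omega⟩ = g ⟨i + 1, hi⟩ →
          σ ⟨i, by omega⟩ < σ ⟨i + 1, hi⟩ := by
        intro i hi heq
        by_contra hlt
        have hmem : i + 1 ∈ descentSet σ :=
          ⟨by omega, Or.inr ⟨hi, lt_of_le_of_ne (not_lt.1 hlt) (by simp)⟩⟩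
        exact (mem_partialSums_content_iff hg (by omega) hi).1 (h hmem) (by simpa using heq)
      induction k with
      | zero => intro i hk heq; exact succ i hk heq
      | succ k ih =>
        intro i hk heq
        have hmid : g i = g ⟨i + (k + 1), by omega⟩ :=
          le_antisymm (hg (by simp [Fin.le_def])) (heq ▸ hg (by simp [Fin.le_def]))
        exact (ih i (by omega) hmid).trans (succ (i + (k + 1)) hk (hmid ▸ heq))
    intro i j hij heq
    obtain ⟨k, hk⟩ : ∃ k, (j : ℕ) = i + (k + 1) := ⟨j - i - 1, by
      have : (i : ℕ) < j := hij
      omega⟩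
    have hj : j = ⟨i + (k + 1), hk ▸ j.2⟩ := Fin.ext hk
    rw [hj]
    exact step k i _ (hj ▸ heq)
  · rintro h i ⟨h1, rfl | ⟨hi, hlt⟩⟩
    · exact card_mem_partialSums_content g h1
    · rw [mem_partialSums_content_iff hg h1 hi]
      intro heq
      exact absurd (h _ _ (by simp [Fin.lt_def]; omega) heq) hlt.not_gt

/-- `Tuple.sort` breaks ties by position. Here `π⁻¹` turns the word back into the sorted `w`, so it
is the stable sort exactly when it increases on each block of equal letters, which is the descent
condition. -/
theorem mem_interleavings_iff {a n : ℕ} (w : Fin n → Fin a) (π : Equiv.Perm (Fin n)) :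
    π ∈ interleavings n (content w) ↔ Tuple.sort (w ∘ Tuple.sort w ∘ π) = π⁻¹ := by
  have hg := Tuple.monotone_sort w
  have hdef : π ∈ interleavings n (content w) ↔ descentSet π⁻¹ ⊆ partialSums (content w) := by
    simp [interleavings]
  rw [hdef, ← content_comp_perm w (Tuple.sort w),
    descentSet_subset_partialSums_iff hg, eq_comm (b := π⁻¹), Tuple.eq_sort_iff]
  have : (w ∘ Tuple.sort w ∘ π) ∘ (π⁻¹ : Equiv.Perm (Fin n)) = w ∘ Tuple.sort w := by
    funext i; simp
  rw [this]
  simp [hg]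

/-- Words of given content correspond to interleavings by sorting. -/
theorem card_sort_eq {a n : ℕ} (b : Fin a → ℕ) (hb : ∑ c, b c = n) (π : Equiv.Perm (Fin n)) :
    #{w : Fin n → Fin a | content w = b ∧ (Tuple.sort w)⁻¹ = π} =
      if π ∈ interleavings n b then 1 else 0 := by
  obtain ⟨w₀, rfl⟩ : ∃ w : Fin n → Fin a, content w = b := by
    have : 0 < #{w : Fin n → Fin a | content w = b} := by
      rw [card_content_eq b hb]; exact Nat.multinomial_pos _ _
    obtain ⟨w, hw⟩ := card_pos.1 this
    exact ⟨w, by simpa using hw⟩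
  have huniq : ∀ w : Fin n → Fin a, content w = content w₀ → (Tuple.sort w)⁻¹ = π →
      w = w₀ ∘ Tuple.sort w₀ ∘ π := by
    rintro w hw rfl
    have : w ∘ Tuple.sort w = w₀ ∘ Tuple.sort w₀ := by
      refine eq_of_monotone_of_card_fiber_eq (Tuple.monotone_sort _) (Tuple.monotone_sort _) ?_
      intro c
      exact congrFun ((content_comp_perm w _).trans (hw.trans (content_comp_perm w₀ _).symm)) c
    rw [← Function.comp_assoc, ← this]
    funext i
    simp
  split_ifs with h
  · rw [card_eq_one]
    refine ⟨w₀ ∘ Tuple.sort w₀ ∘ π, ?_⟩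
    ext w
    simp only [mem_filter, mem_univ, true_and, mem_singleton]
    refine ⟨fun hw => huniq w hw.1 hw.2, ?_⟩
    rintro rfl
    refine ⟨?_, by rw [(mem_interleavings_iff w₀ π).1 h, inv_inv]⟩
    rw [← Function.comp_assoc, content_comp_perm, content_comp_perm]
  · rw [card_eq_zero, filter_eq_empty_iff]
    rintro w - ⟨hw, hπ⟩
    apply h
    rw [mem_interleavings_iff, ← huniq w hw hπ, ← hπ, inv_inv]

theorem card_interleavings {a n : ℕ} (b : Fin a → ℕ) (hb : ∑ c, b c = n) :
    #(interleavings n b) = Nat.multinomial univ b := by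
  classical
  rw [← card_content_eq b hb, card_eq_sum_card_fiberwise (t := univ)
    (f := fun w : Fin n → Fin a => (Tuple.sort w)⁻¹) (by simp)]
  simp_rw [filter_filter, card_sort_eq b hb]
  simp

/-- A biased shuffle is the inverse of the sorting permutation of a word with independent
letters. -/
theorem shuffleMass_eq_sum_words {a : ℕ} (n : ℕ) (p : Fin a → ℝ) (π : Equiv.Perm (Fin n)) :
    shuffleMass n p π =
      ∑ w : Fin n → Fin a, if (Tuple.sort w)⁻¹ = π then ∏ i, p (w i) else 0 := by
  classical
  rw [shuffleMass, ← sum_fiberwise_of_maps_to (g := content)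
    (fun w _ => content_mem_piAntidiag (n := n) w)]
  refine sum_congr rfl fun b hb => ?_
  have hb' : ∑ c, b c = n := by simpa using hb
  have hne : (Nat.multinomial univ b : ℝ) ≠ 0 :=
    Nat.cast_ne_zero.2 (Nat.multinomial_pos _ _).ne'
  have h1 : ∀ w ∈ (univ : Finset (Fin n → Fin a)).filter (fun w => content w = b),
      (if (Tuple.sort w)⁻¹ = π then ∏ i, p (w i) else 0) =
        if (Tuple.sort w)⁻¹ = π then ∏ c, p c ^ b c else 0 := by
    intro w hw
    rw [prod_letters, (mem_filter.1 hw).2]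
  -- One word of content `b` gives each interleaving, and the multinomial coefficient cancels the
  -- number of interleavings.
  rw [sum_congr rfl h1, ← sum_filter, filter_filter, sum_const, card_sort_eq b hb',
    card_interleavings b hb']
  split_ifs <;> field_simp <;> simp

theorem shuffleExpect_eq_sum_words {a : ℕ} (n : ℕ) (p : Fin a → ℝ) {V : Type*} [AddCommMonoid V]
    [Module ℝ V] (f : Equiv.Perm (Fin n) → V) :
    shuffleExpect n p f = ∑ w : Fin n → Fin a, (∏ i, p (w i)) • f (Tuple.sort w)⁻¹ := by
  simp_rw [shuffleExpect, shuffleMass_eq_sum_words, sum_smul]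
  rw [sum_comm]
  simp [ite_smul]

end BiasedShuffle

/-! ### The Gessel–Reutenauer correspondence via periodic sequences. -/

namespace BiasedShuffle

open Finset Function

/-- Infinite words in `a` letters with (not necessarily minimal) period `L`. -/
structure PeriodicSeq (a L : ℕ) where
  /-- The letter at each position. -/
  letter : ℕ → Fin a
  letter_add : ∀ t, letter (t + L) = letter t

namespace PeriodicSeq

variable {a L : ℕ}

instance : CoeFun (PeriodicSeq a L) fun _ => ℕ → Fin a := ⟨letter⟩

@[ext]
theorem ext {x y : PeriodicSeq a L} (h : ∀ t, x t = y t) : x = y := by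
  obtain ⟨x, hx⟩ := x
  obtain ⟨y, hy⟩ := y
  obtain rfl : x = y := funext h
  rfl

theorem apply_add_mul (x : PeriodicSeq a L) (t k : ℕ) : x (t + L * k) = x t := by
  induction k with
  | zero => rfl
  | succ k ih => rw [mul_add, mul_one, ← add_assoc, x.letter_add, ih]

theorem apply_mod (x : PeriodicSeq a L) (t : ℕ) : x (t % L) = x t := by
  conv_rhs => rw [← Nat.mod_add_div t L, x.apply_add_mul]

noncomputable instance [NeZero L] : Fintype (PeriodicSeq a L) := by
  refine Fintype.ofInjective (β := Fin L → Fin a) (fun x t => x t) fun x y h => ?_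
  ext t
  have := congrFun h ⟨t % L, Nat.mod_lt _ (NeZero.pos L)⟩
  simp only [apply_mod] at this
  rw [this]

/-- Periodic sequences are compared lexicographically. -/
noncomputable instance : LinearOrder (PeriodicSeq a L) :=
  LinearOrder.lift' (fun x => toLex (x : ℕ → Fin a)) fun _ _ h => ext (congrFun (toLex.injective h))

theorem lt_iff {x y : PeriodicSeq a L} : x < y ↔ ∃ t, (∀ s < t, x s = y s) ∧ x t < y t :=
  Iff.rfl

theorem lt_of_head_lt {x y : PeriodicSeq a L} (h : x 0 < y 0) : x < y :=
  lt_iff.2 ⟨0, by simp, h⟩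

/-- Deletion of the first letter. -/
def shift [NeZero L] : Equiv.Perm (PeriodicSeq a L) where
  toFun x := ⟨fun t => x (t + 1), fun t => by simp only [add_right_comm t L, x.letter_add]⟩
  invFun x := ⟨fun t => x (t + (L - 1)), fun t => by simp only [add_right_comm t L, x.letter_add]⟩
  left_inv x := by
    refine ext fun t => ?_
    have := NeZero.pos L
    change x (t + (L - 1) + 1) = _
    rw [show t + (L - 1) + 1 = t + L by omega, x.letter_add]
  right_inv x := by
    refine ext fun t => ?_
    have := NeZero.pos L
    change x (t + 1 + (L - 1)) = _
    rw [show t + 1 + (L - 1) = t + L by omega, x.letter_add]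

variable [NeZero L]

theorem shift_apply (x : PeriodicSeq a L) (t : ℕ) : shift x t = x (t + 1) := rfl

theorem iterate_shift_apply (x : PeriodicSeq a L) (k t : ℕ) : (shift^[k] x) t = x (t + k) := by
  induction k generalizing x with
  | zero => rfl
  | succ k ih => rw [iterate_succ_apply, ih, shift_apply, add_assoc]

theorem isPeriodicPt_shift_iff (x : PeriodicSeq a L) (k : ℕ) :
    IsPeriodicPt shift k x ↔ ∀ t, x (t + k) = x t := by
  simp_rw [← iterate_shift_apply]
  exact ⟨fun h t => by rw [h.eq], fun h => ext h⟩

theorem isPeriodicPt_shift (x : PeriodicSeq a L) : IsPeriodicPt shift L x :=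
  (isPeriodicPt_shift_iff x L).2 x.letter_add

theorem lt_of_shift_lt {x y : PeriodicSeq a L} (h0 : x 0 = y 0) (h : shift x < shift y) :
    x < y := by
  obtain ⟨t, ht, hlt⟩ := lt_iff.1 h
  refine lt_iff.2 ⟨t + 1, fun s hs => ?_, hlt⟩
  cases s with
  | zero => exact h0
  | succ s => exact ht s (by omega)

theorem le_of_shift_le {x y : PeriodicSeq a L} (h0 : x 0 = y 0) (h : shift x ≤ shift y) :
    x ≤ y := by
  rcases h.lt_or_eq with h | h
  · exact (lt_of_shift_lt h0 h).le
  · exact (shift.injective h).le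

end PeriodicSeq

open PeriodicSeq

variable {a n : ℕ}

instance : NeZero n.factorial := ⟨n.factorial_ne_zero⟩

theorem sort_apply_lt {w : Fin n → Fin a} {i j : Fin n} (hij : i < j)
    (h : w (Tuple.sort w i) = w (Tuple.sort w j)) : Tuple.sort w i < Tuple.sort w j :=
  (Tuple.eq_sort_iff.1 rfl).2 i j hij h

/-- The letters read along the cycle of `i` under the sorting permutation of the word `w`. -/
def cycleSeq (w : Fin n → Fin a) (i : Fin n) : PeriodicSeq a n.factorial :=
  -- Starting at exponent `1` makes the heads, read over `i`, the sorted word. The period `n!` kills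
  -- every permutation.
  ⟨fun t => w ((Tuple.sort w ^ (t + 1)) i), fun t => by
    have h : Tuple.sort w ^ n.factorial = 1 := by
      simpa [Fintype.card_perm] using pow_card_eq_one (x := Tuple.sort w)
    simp only [add_right_comm t _ 1, pow_add _ (t + 1), h, mul_one]⟩

theorem cycleSeq_zero (w : Fin n → Fin a) (i : Fin n) :
    cycleSeq w i 0 = w (Tuple.sort w i) := rfl

theorem shift_cycleSeq (w : Fin n → Fin a) (i : Fin n) :
    shift (cycleSeq w i) = cycleSeq w (Tuple.sort w i) := by
  ext t
  change (w ((Tuple.sort w ^ (t + 1 + 1)) i) : ℕ) = w ((Tuple.sort w ^ (t + 1)) (Tuple.sort w i))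
  rw [pow_succ _ (t + 1)]
  rfl

theorem iterate_shift_cycleSeq (w : Fin n → Fin a) (k : ℕ) (i : Fin n) :
    shift^[k] (cycleSeq w i) = cycleSeq w ((Tuple.sort w)^[k] i) := by
  have h : Semiconj (cycleSeq w) (Tuple.sort w) shift := fun i => (shift_cycleSeq w i).symm
  exact (h.iterate_right k i).symm

theorem letter_eq_shift_symm_cycleSeq (w : Fin n → Fin a) (j : Fin n) :
    w j = shift.symm (cycleSeq w j) 0 := by
  obtain ⟨i, rfl⟩ := (Tuple.sort w).surjective j
  rw [← shift_cycleSeq, Equiv.symm_apply_apply, cycleSeq_zero]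

/-- As long as the letters agree, stability preserves the order of the two orbits; at the first
difference sortedness decides it. -/
theorem cycleSeq_monotone (w : Fin n → Fin a) : Monotone (cycleSeq w) := by
  intro i j hij
  by_contra hlt
  obtain ⟨t, ht, hlt⟩ := lt_iff.1 (not_le.1 hlt)
  have key : ∀ s ≤ t, (Tuple.sort w ^ s) i ≤ (Tuple.sort w ^ s) j := by
    intro s hs
    induction s with
    | zero => exact hij
    | succ s ih =>
      rcases (ih (by omega)).lt_or_eq with h | h
      · rw [pow_succ', Equiv.Perm.mul_apply, Equiv.Perm.mul_apply]
        refine (sort_apply_lt h ?_).le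
        have := ht s (by omega)
        simp only [cycleSeq, pow_succ', Equiv.Perm.mul_apply] at this
        exact this.symm
      · rw [pow_succ', Equiv.Perm.mul_apply, Equiv.Perm.mul_apply, h]
  refine hlt.not_ge ?_
  have := Tuple.monotone_sort w (key t le_rfl)
  simpa only [cycleSeq, pow_succ', Equiv.Perm.mul_apply, comp_apply] using this

theorem iterate_sort_lt {w : Fin n → Fin a} {i j : Fin n} (hij : i < j)
    (h : cycleSeq w i = cycleSeq w j) (k : ℕ) : (Tuple.sort w)^[k] i < (Tuple.sort w)^[k] j := by
  induction k with
  | zero => exact hij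
  | succ k ih =>
    rw [iterate_succ_apply', iterate_succ_apply']
    refine sort_apply_lt ih ?_
    have := congrArg (fun x => shift^[k] x 0) h
    simpa only [iterate_shift_cycleSeq, cycleSeq_zero] using this

/-- The letters along each cycle of the sorting permutation form a primitive word. -/
theorem minimalPeriod_cycleSeq (w : Fin n → Fin a) (i : Fin n) :
    minimalPeriod shift (cycleSeq w i) = minimalPeriod (Tuple.sort w) i := by
  rw [minimalPeriod_eq_minimalPeriod_iff]
  intro d
  simp only [IsPeriodicPt, IsFixedPt, iterate_shift_cycleSeq]
  refine ⟨fun h => ?_, fun h => by rw [h]⟩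
  set τ := (Tuple.sort w)^[d] with hτ
  have hseq : ∀ k, cycleSeq w (τ^[k] i) = cycleSeq w i := by
    intro k
    induction k with
    | zero => rfl
    | succ k ih =>
      rw [iterate_succ_apply', hτ, ← iterate_shift_cycleSeq, ih, iterate_shift_cycleSeq, h]
  -- If `τ` moved `i`, stability would make its iterates strictly monotone, which is impossible in a
  -- finite set.
  rcases lt_trichotomy (τ i) i with hlt | heq | hlt
  · have : StrictAnti fun k => τ^[k] i := strictAnti_nat_of_succ_lt fun k => by
      rw [iterate_succ_apply, ← iterate_mul]
      exact iterate_sort_lt hlt h _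
    exact absurd this.injective (not_injective_infinite_finite _)
  · exact heq
  · have : StrictMono fun k => τ^[k] i := strictMono_nat_of_lt_succ fun k => by
      rw [iterate_succ_apply, ← iterate_mul]
      exact iterate_sort_lt hlt h.symm _
    exact absurd this.injective (not_injective_infinite_finite _)

/-- The multiplicity of a periodic sequence among the sequences attached to a word. -/
noncomputable def seqMult (w : Fin n → Fin a) (x : PeriodicSeq a n.factorial) : ℕ :=
  #{i | cycleSeq w i = x}

theorem seqMult_shift (w : Fin n → Fin a) (x : PeriodicSeq a n.factorial) :
    seqMult w (shift x) = seqMult w x := by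
  refine (card_bij (fun i _ => Tuple.sort w i) ?_ (by simp) ?_).symm
  · simp only [mem_filter_univ]
    rintro i rfl
    exact (shift_cycleSeq w i).symm
  · simp only [mem_filter_univ]
    intro j hj
    obtain ⟨i, rfl⟩ := (Tuple.sort w).surjective j
    rw [← shift_cycleSeq] at hj
    exact ⟨i, shift.injective hj, rfl⟩

theorem sum_seqMult (w : Fin n → Fin a) : ∑ x, seqMult w x = n := by
  simpa [seqMult] using (card_eq_sum_card_fiberwise (s := (univ : Finset (Fin n)))
    (t := univ) (f := cycleSeq w) (by simp)).symm

theorem seqMult_injective : Injective (seqMult : (Fin n → Fin a) → _) := by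
  intro w w' h
  have : cycleSeq w = cycleSeq w' := eq_of_monotone_of_card_fiber_eq (cycleSeq_monotone w)
    (cycleSeq_monotone w') fun x => congrFun h x
  funext j
  rw [letter_eq_shift_symm_cycleSeq w, this, ← letter_eq_shift_symm_cycleSeq]

theorem exists_monotone_card_fiber_eq {α : Type*} [Fintype α] [LinearOrder α] (m : α → ℕ)
    (hm : ∑ x, m x = n) : ∃ v : Fin n → α, Monotone v ∧ ∀ x, #{i | v i = x} = m x := by
  have e : Fin n ≃ Σ x, Fin (m x) := Fintype.equivOfCardEq (by simp [hm])
  refine ⟨(fun i => (e i).1) ∘ Tuple.sort (fun i => (e i).1), Tuple.monotone_sort _, fun x => ?_⟩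
  rw [← Fintype.card_fin (m x), ← card_univ]
  refine (card_bij (fun k _ => (Tuple.sort (fun i => (e i).1)).symm (e.symm ⟨x, k⟩)) ?_ ?_ ?_).symm
  · simp
  · simp
  · intro i hi
    simp only [mem_filter_univ, comp_apply] at hi
    subst hi
    exact ⟨(e (Tuple.sort (fun i => (e i).1) i)).2, by simp, by simp⟩

/-- Every shift-invariant multiset of `n` periodic sequences comes from a word of length `n`. -/
theorem exists_seqMult_eq (m : PeriodicSeq a n.factorial → ℕ) (hinv : ∀ x, m (shift x) = m x)
    (hm : ∑ x, m x = n) : ∃ w : Fin n → Fin a, seqMult w = m := by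
  obtain ⟨v, hv, hvm⟩ := exists_monotone_card_fiber_eq m hm
  -- Inverse Burrows–Wheeler transform: `w j` is the letter preceding the `j`-th sequence in sorted
  -- order.
  let w : Fin n → Fin a := fun j => shift.symm (v j) 0
  -- Prefixing the letters of `w` permutes the multiset, by shift invariance. Stable sorting by the
  -- new heads, with ties ordered by the tails `v`, puts the sequences in order, so the list is `v`
  -- again.
  have hshift : (fun i => shift.symm (v (Tuple.sort w i))) = v := by
    refine eq_of_monotone_of_card_fiber_eq ?_ hv fun x => ?_
    · intro i j hij
      rcases hij.lt_or_eq with hij | rfl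
      · rcases (Tuple.monotone_sort w hij.le).lt_or_eq with h | h
        · exact (lt_of_head_lt h).le
        · refine le_of_shift_le h ?_
          rw [Equiv.apply_symm_apply, Equiv.apply_symm_apply]
          exact hv (sort_apply_lt hij h).le
      · exact le_rfl
    · rw [hvm, ← hinv, ← hvm]
      refine card_bij (fun i _ => Tuple.sort w i) ?_ (by simp) ?_
      · simp [Equiv.symm_apply_eq]
      · intro j hj
        exact ⟨(Tuple.sort w).symm j, by simpa [Equiv.symm_apply_eq] using hj, by simp⟩
  have hsucc : ∀ i, shift (v i) = v (Tuple.sort w i) := fun i => by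
    rw [← congrFun hshift i, Equiv.apply_symm_apply]
  have hiter : ∀ t i, v i t = w ((Tuple.sort w ^ (t + 1)) i) := by
    intro t
    induction t with
    | zero =>
      intro i
      rw [zero_add, pow_one, ← congrFun hshift i]
    | succ t ih =>
      intro i
      rw [← shift_apply, hsucc, ih, pow_succ _ (t + 1)]
      rfl
  refine ⟨w, funext fun x => ?_⟩
  have hv' : cycleSeq w = v := funext fun i => ext fun t => (hiter t i).symm
  rw [← hvm, seqMult, hv']

end BiasedShuffle

/-! ### Necklaces, letter weights and cycle counts. -/

namespace BiasedShuffle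

open Finset Function PeriodicSeq

variable {a n L : ℕ}

/-- A primitive necklace whose length divides `L`: an orbit of the shift. -/
def Necklace (a L : ℕ) [NeZero L] : Type :=
  Quotient (Equiv.Perm.SameCycle.setoid (shift : Equiv.Perm (PeriodicSeq a L)))

namespace Necklace

variable [NeZero L]

/-- The necklace obtained from a periodic sequence. -/
def mk (x : PeriodicSeq a L) : Necklace a L := Quotient.mk _ x

theorem mk_surjective : Surjective (mk : PeriodicSeq a L → Necklace a L) := Quotient.mk_surjective

theorem mk_eq_mk_iff {x y : PeriodicSeq a L} :
    mk x = mk y ↔ ∃ t < minimalPeriod shift x, shift^[t] x = y := by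
  have hpos : 0 < minimalPeriod shift x :=
    (isPeriodicPt_shift x).minimalPeriod_pos (NeZero.pos L)
  refine Iff.trans (Quotient.eq (r := Equiv.Perm.SameCycle.setoid shift)) ?_
  constructor
  · intro h
    obtain ⟨k, hk⟩ := Equiv.Perm.SameCycle.exists_nat_pow_eq h
    refine ⟨k % minimalPeriod shift x, Nat.mod_lt _ hpos, ?_⟩
    rw [iterate_mod_minimalPeriod_eq, ← hk, Equiv.Perm.coe_pow]
  · rintro ⟨t, -, rfl⟩
    exact ⟨t, by simp [Equiv.Perm.coe_pow]⟩

theorem mk_shift (x : PeriodicSeq a L) : mk (shift x) = mk x :=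
  Quotient.sound ⟨-1, by simp⟩

noncomputable instance : DecidableEq (Necklace a L) := Classical.decEq _

noncomputable instance : Fintype (Necklace a L) := Fintype.ofSurjective mk mk_surjective

/-- The number of beads. -/
noncomputable def length (q : Necklace a L) : ℕ := #{x | mk x = q}

/-- The number of beads carrying each letter. -/
noncomputable def content (q : Necklace a L) : Fin a → ℕ := fun c => #{x | mk x = q ∧ x 0 = c}

theorem prod_fiber_mk {R : Type*} [CommMonoid R] (f : PeriodicSeq a L → R)
    (x : PeriodicSeq a L) :
    ∏ y with mk y = mk x, f y = ∏ t ∈ range (minimalPeriod shift x), f (shift^[t] x) := by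
  symm
  refine prod_bij (fun t _ => shift^[t] x) ?_ ?_ ?_ (fun _ _ => rfl)
  · intro t ht
    rw [mem_filter_univ, eq_comm, mk_eq_mk_iff]
    exact ⟨t, by simpa using ht, rfl⟩
  · intro s hs t ht h
    exact iterate_injOn_Iio_minimalPeriod (by simpa using hs) (by simpa using ht) h
  · intro y hy
    rw [mem_filter_univ, eq_comm, mk_eq_mk_iff] at hy
    obtain ⟨t, ht, rfl⟩ := hy
    exact ⟨t, by simpa using ht, rfl⟩

theorem sum_fiber_mk {R : Type*} [AddCommMonoid R] (f : PeriodicSeq a L → R)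
    (x : PeriodicSeq a L) :
    ∑ y with mk y = mk x, f y = ∑ t ∈ range (minimalPeriod shift x), f (shift^[t] x) :=
  prod_fiber_mk (R := Multiplicative R) f x

theorem length_mk (x : PeriodicSeq a L) : (mk x).length = minimalPeriod shift x := by
  rw [length, card_eq_sum_ones, sum_fiber_mk]
  simp

theorem length_dvd (q : Necklace a L) : q.length ∣ L := by
  obtain ⟨x, rfl⟩ := mk_surjective q
  rw [length_mk]
  exact (isPeriodicPt_shift x).minimalPeriod_dvd

theorem length_pos (q : Necklace a L) : 0 < q.length :=
  Nat.pos_of_dvd_of_pos q.length_dvd (NeZero.pos L)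

theorem content_mk (x : PeriodicSeq a L) (c : Fin a) :
    (mk x).content c = #{t ∈ range (minimalPeriod shift x) | x t = c} := by
  rw [content, ← filter_filter, card_filter, sum_fiber_mk, card_filter]
  simp [iterate_shift_apply]

theorem sum_content (q : Necklace a L) : ∑ c, q.content c = q.length := by
  simp_rw [content, ← filter_filter]
  exact (card_eq_sum_card_fiberwise (s := {x | mk x = q}) (t := univ)
    (f := fun x : PeriodicSeq a L => x 0) (by simp)).symm

theorem prod_content {R : Type*} [CommMonoid R] (p : Fin a → R) (q : Necklace a L) :
    ∏ x with mk x = q, p (x 0) = ∏ c, p c ^ q.content c := by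
  rw [← prod_fiberwise_of_maps_to (t := univ) (g := fun x : PeriodicSeq a L => x 0) (by simp)]
  refine prod_congr rfl fun c _ => ?_
  rw [prod_congr rfl (g := fun _ => p c) (by simp +contextual), prod_const, content, filter_filter]

theorem sum_comp_mk (f : Necklace a L → ℕ) : ∑ x, f (mk x) = ∑ q, q.length * f q := by
  rw [← sum_fiberwise_of_maps_to (t := univ) (g := mk) (by simp)]
  refine sum_congr rfl fun q _ => ?_
  rw [sum_congr rfl (g := fun _ => f q) (by simp +contextual), sum_const, length, smul_eq_mul]

end Necklace

/-- The multiplicity of a necklace in the multiset of necklaces attached to a word. -/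
noncomputable def necklaceMult (w : Fin n → Fin a) (q : Necklace a n.factorial) : ℕ :=
  seqMult w (surjInv Necklace.mk_surjective q)

theorem necklaceMult_mk (w : Fin n → Fin a) (x : PeriodicSeq a n.factorial) :
    necklaceMult w (Necklace.mk x) = seqMult w x := by
  obtain ⟨t, -, ht⟩ := Necklace.mk_eq_mk_iff.1
    (surjInv_eq Necklace.mk_surjective (Necklace.mk x)).symm
  rw [necklaceMult, ← ht]
  clear ht
  induction t with
  | zero => rfl
  | succ t ih => rw [iterate_succ_apply', seqMult_shift, ih]

theorem sum_length_mul_necklaceMult (w : Fin n → Fin a) :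
    ∑ q, q.length * necklaceMult w q = n := by
  rw [← Necklace.sum_comp_mk]
  simp_rw [necklaceMult_mk, sum_seqMult]

theorem necklaceMult_injective : Injective (necklaceMult : (Fin n → Fin a) → _) := by
  intro w w' h
  refine seqMult_injective (funext fun x => ?_)
  rw [← necklaceMult_mk, h, necklaceMult_mk]

theorem exists_necklaceMult_eq (m : Necklace a n.factorial → ℕ)
    (hm : ∑ q, q.length * m q = n) : ∃ w : Fin n → Fin a, necklaceMult w = m := by
  obtain ⟨w, hw⟩ := exists_seqMult_eq (fun x => m (Necklace.mk x))
    (fun x => by rw [Necklace.mk_shift]) (by rw [Necklace.sum_comp_mk, hm])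
  refine ⟨w, funext fun q => ?_⟩
  obtain ⟨x, rfl⟩ := Necklace.mk_surjective q
  rw [necklaceMult_mk, hw]

/-- After sorting, the letters are the heads of the cycle sequences; these are grouped by sequence,
then by orbit, along which multiplicity is constant. -/
theorem prod_letters_eq_prod_necklaces {R : Type*} [CommMonoid R] (p : Fin a → R)
    (w : Fin n → Fin a) :
    ∏ i, p (w i) = ∏ q : Necklace a n.factorial, (∏ c, p c ^ q.content c) ^ necklaceMult w q := by
  rw [← Equiv.prod_comp (Tuple.sort w)]
  simp_rw [← cycleSeq_zero]
  rw [← prod_fiberwise_of_maps_to (t := univ) (g := cycleSeq w) (by simp),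
    ← prod_fiberwise_of_maps_to (t := univ) (g := Necklace.mk) (by simp)]
  refine prod_congr rfl fun q _ => ?_
  rw [← Necklace.prod_content, ← prod_pow]
  refine prod_congr rfl fun x hx => ?_
  rw [prod_congr rfl (g := fun _ => p (x 0)) (by simp +contextual), prod_const,
    ← (mem_filter.1 hx).2, necklaceMult_mk, seqMult]

theorem minimalPeriod_eq_card_support_cycleOf (σ : Equiv.Perm (Fin n)) {i : Fin n}
    (hi : σ i ≠ i) : minimalPeriod σ i = #(σ.cycleOf i).support := by
  have hc := Equiv.Perm.isCycle_cycleOf σ hi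
  rw [← hc.orderOf]
  have key : ∀ t, IsPeriodicPt σ t i ↔ orderOf (σ.cycleOf i) ∣ t := by
    intro t
    rw [orderOf_dvd_iff_pow_eq_one, hc.pow_eq_one_iff' (x := i) (by simpa using hi),
      Equiv.Perm.cycleOf_pow_apply_self, Equiv.Perm.coe_pow]
    rfl
  exact Nat.dvd_antisymm ((key _).2 dvd_rfl).minimalPeriod_dvd
    ((key _).1 (isPeriodicPt_minimalPeriod σ i))

/-- Each `k`-cycle has `k` points. Fixed points are treated apart because `cycleType` omits them. -/
theorem numCycles_mul (σ : Equiv.Perm (Fin n)) {k : ℕ} (hk : 1 ≤ k) :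
    numCycles k σ * k = #{i | minimalPeriod σ i = k} := by
  rw [numCycles, Equiv.Perm.parts_partition, Multiset.count_add, Multiset.count_replicate]
  rcases hk.eq_or_lt with rfl | hk
  · have h0 : Multiset.count 1 σ.cycleType = 0 :=
      Multiset.count_eq_zero.2 fun h => by simpa using Equiv.Perm.one_lt_of_mem_cycleType h
    rw [h0, if_pos rfl, zero_add, mul_one, ← card_compl]
    congr 1
    ext i
    simp [minimalPeriod_eq_one_iff_isFixedPt, IsFixedPt]
  · have hne : ∀ i, minimalPeriod σ i = k → σ i ≠ i := fun i hi h => by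
      rw [minimalPeriod_eq_one_iff_isFixedPt.2 h] at hi
      omega
    rw [if_neg hk.ne, add_zero, Equiv.Perm.cycleType_def, Multiset.count_map]
    have hmaps : ∀ i ∈ ({i | minimalPeriod σ i = k} : Finset (Fin n)),
        σ.cycleOf i ∈ {c ∈ σ.cycleFactorsFinset | k = (card ∘ Equiv.Perm.support) c} := by
      intro i hi
      rw [mem_filter_univ] at hi
      rw [mem_filter, Equiv.Perm.cycleOf_mem_cycleFactorsFinset_iff, Equiv.Perm.mem_support]
      exact ⟨hne i hi, by rw [← hi, minimalPeriod_eq_card_support_cycleOf σ (hne i hi)]; rfl⟩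
    rw [card_eq_sum_card_fiberwise hmaps, ← filter_val, ← card_def, ← smul_eq_mul, ← sum_const]
    refine sum_congr rfl fun c hc => ?_
    obtain ⟨hc, hck⟩ := mem_filter.1 hc
    conv_lhs => rw [hck]
    refine congrArg card ?_
    ext i
    simp only [mem_filter, mem_univ, true_and]
    constructor
    · intro hi
      have := Equiv.Perm.cycle_is_cycleOf hi hc
      refine ⟨?_, this.symm⟩
      rw [minimalPeriod_eq_card_support_cycleOf σ, ← this, hck]
      · rfl
      · exact Equiv.Perm.mem_support.1 (Equiv.Perm.mem_cycleFactorsFinset_support_le hc hi)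
    · rintro ⟨hi, rfl⟩
      rw [Equiv.Perm.mem_support, Equiv.Perm.cycleOf_apply_self]
      exact hne i hi

theorem numCycles_inv (σ : Equiv.Perm (Fin n)) (k : ℕ) : numCycles k σ⁻¹ = numCycles k σ := by
  simp [numCycles, Equiv.Perm.parts_partition]

/-- Multiplied by `k`, both sides count the positions whose cycle sequence has least period `k`. -/
theorem numCycles_sort (w : Fin n → Fin a) {k : ℕ} (hk : 1 ≤ k) :
    numCycles k (Tuple.sort w) =
      ∑ q : Necklace a n.factorial with q.length = k, necklaceMult w q := by
  refine Nat.eq_of_mul_eq_mul_right hk ?_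
  rw [numCycles_mul _ hk, sum_mul]
  simp_rw [← minimalPeriod_cycleSeq]
  have h := Necklace.sum_comp_mk
    (fun q : Necklace a n.factorial => if q.length = k then necklaceMult w q else 0)
  simp_rw [necklaceMult_mk, Necklace.length_mk, mul_ite, mul_zero] at h
  rw [← sum_filter, ← sum_filter] at h
  rw [sum_congr rfl (g := fun q : Necklace a n.factorial => q.length * necklaceMult w q)
    (fun q hq => by rw [(mem_filter.1 hq).2, mul_comm]), ← h,
    card_eq_sum_card_fiberwise (f := cycleSeq w)
      (t := {x | minimalPeriod shift x = k}) (by simp [Set.MapsTo])]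
  refine sum_congr rfl fun x hx => congrArg card ?_
  ext i
  simp only [mem_filter, mem_univ, true_and] at hx ⊢
  exact ⟨fun h => h.2, fun h => ⟨h ▸ hx, h⟩⟩

theorem prod_pow_numCycles_sort {R : Type*} [CommMonoid R] (f : ℕ → R) (w : Fin n → Fin a) :
    ∏ k ∈ Icc 1 n, f k ^ numCycles k (Tuple.sort w) =
      ∏ q : Necklace a n.factorial, f q.length ^ necklaceMult w q := by
  -- The period `n!` allows necklaces longer than `n`, but the total length `n` leaves them no
  -- multiplicity.
  have h0 : ∀ q : Necklace a n.factorial, q.length ∉ Icc 1 n → necklaceMult w q = 0 := by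
    intro q hq
    by_contra hne
    refine hq (mem_Icc.2 ⟨q.length_pos, ?_⟩)
    calc q.length ≤ q.length * necklaceMult w q := Nat.le_mul_of_pos_right _ (by omega)
      _ ≤ ∑ q, q.length * necklaceMult w q :=
        single_le_sum (f := fun q => q.length * necklaceMult w q) (by simp) (mem_univ q)
      _ = n := sum_length_mul_necklaceMult w
  rw [← prod_subset (filter_subset (fun q : Necklace a n.factorial => q.length ∈ Icc 1 n) univ)
    (fun q _ hq => by rw [h0 q (by simpa using hq), pow_zero]),
    ← prod_fiberwise_of_maps_to (t := Icc 1 n) (g := Necklace.length)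
      (fun q hq => (mem_filter.1 hq).2)]
  refine prod_congr rfl fun k hk => ?_
  rw [numCycles_sort w (mem_Icc.1 hk).1, ← prod_pow_eq_pow_sum, filter_filter]
  refine prod_congr ?_ fun q hq => by rw [(mem_filter.1 hq).2.2]
  ext q
  simp only [mem_filter_univ]
  exact ⟨fun h => ⟨h ▸ hk, h⟩, fun h => h.2⟩

end BiasedShuffle

/-! ### Counting primitive necklaces by Möbius inversion. -/

namespace BiasedShuffle

open Finset Function PeriodicSeq

variable {a L : ℕ} [NeZero L]

/-- The letter counts of a periodic sequence over `k` periods. -/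
theorem PeriodicSeq.content_window (x : PeriodicSeq a L) (k : ℕ) :
    content (fun t : Fin (minimalPeriod shift x * k) => x t) = k • (Necklace.mk x).content := by
  funext c
  have hper := (isPeriodicPt_shift_iff x _).1 (isPeriodicPt_minimalPeriod shift x)
  rw [Pi.smul_apply, smul_eq_mul, Necklace.content_mk, content]
  rw [card_filter, Fin.sum_univ_eq_sum_range (fun t => if x t = c then 1 else 0), card_filter]
  induction k with
  | zero => simp
  | succ k ih =>
    have hshift : ∀ t, x (minimalPeriod shift x * k + t) = x t := by
      intro t
      clear ih
      induction k with
      | zero => simp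
      | succ k ih => rw [mul_add, mul_one, add_right_comm, hper, ih]
    rw [mul_add, mul_one, sum_range_add, ih, add_mul, one_mul]
    simp_rw [hshift]

open Classical in
/-- Words of content `r` correspond to the periodic sequences whose necklace content divides
`r`. -/
theorem card_necklace_content_dvd {m : ℕ} (r : Fin a → ℕ) (hr : ∑ c, r c = m) (hm : 0 < m)
    (hL : m ∣ L) :
    #{x : PeriodicSeq a L | ∃ d : ℕ, d • (Necklace.mk x).content = r} = Nat.multinomial univ r := by
  rw [← card_content_eq r hr]
  have hm_eq : ∀ (x : PeriodicSeq a L) (d : ℕ), d • (Necklace.mk x).content = r →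
      m = minimalPeriod shift x * d := by
    rintro x d rfl
    rw [← hr, ← Necklace.length_mk, ← Necklace.sum_content, mul_comm, mul_sum]
    rfl
  refine card_bij (fun x _ (t : Fin m) => x t) ?_ ?_ ?_
  · intro x hx
    obtain ⟨d, hd⟩ := (mem_filter.1 hx).2
    obtain rfl := hm_eq x d hd
    rw [mem_filter_univ, content_window, hd]
  · intro x hx y hy h
    obtain ⟨d, hd⟩ := (mem_filter.1 hx).2
    obtain ⟨e, he⟩ := (mem_filter.1 hy).2
    have hxm : IsPeriodicPt shift m x := by
      rw [hm_eq x d hd]; exact (isPeriodicPt_minimalPeriod shift x).mul_const d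
    have hym : IsPeriodicPt shift m y := by
      rw [hm_eq y e he]; exact (isPeriodicPt_minimalPeriod shift y).mul_const e
    refine PeriodicSeq.ext fun t => ?_
    have h' := congrFun h ⟨t % m, Nat.mod_lt _ hm⟩
    have hmod : ∀ z : PeriodicSeq a L, IsPeriodicPt shift m z → z (t % m) = z t := by
      intro z hz
      have := congrArg (fun z => z 0) (hz.iterate_mod_apply t)
      simpa [iterate_shift_apply] using this
    rw [← hmod x hxm, ← hmod y hym]
    exact h'
  · intro w hw
    rw [mem_filter_univ] at hw
    let x : PeriodicSeq a L := ⟨fun t => w ⟨t % m, Nat.mod_lt _ hm⟩, fun t => by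
      simp [Nat.add_mod, Nat.mod_eq_zero_of_dvd hL]⟩
    have hwx : w = fun t : Fin m => x t := by
      funext t
      simp [x, Nat.mod_eq_of_lt t.2]
    have hper : IsPeriodicPt shift m x := by
      rw [isPeriodicPt_shift_iff]
      intro t
      simp [x]
    refine ⟨x, ?_, hwx.symm⟩
    obtain ⟨k, hk⟩ := hper.minimalPeriod_dvd
    rw [mem_filter_univ]
    refine ⟨k, ?_⟩
    rw [← content_window, ← hw, hwx]
    clear_value x
    subst hk
    rfl

theorem card_mk_content_eq (r : Fin a → ℕ) :
    #{x : PeriodicSeq a L | (Necklace.mk x).content = r} =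
      (∑ c, r c) * #{q : Necklace a L | q.content = r} := by
  have h := Necklace.sum_comp_mk (fun q : Necklace a L => if q.content = r then 1 else 0)
  rw [card_filter, h, card_filter, mul_sum]
  refine sum_congr rfl fun q _ => ?_
  split_ifs with hq
  · rw [← hq, Necklace.sum_content]
  · simp

/-- Words of content `g • r`, where the entries of `r` are coprime, split according to their
primitive roots. -/
theorem sum_divisors_card_mk_content (r : Fin a → ℕ) (hcop : univ.gcd r = 1) {g : ℕ} (hg : 0 < g)
    (hr : 0 < ∑ c, r c) (hL : g * ∑ c, r c ∣ L) :
    ∑ k ∈ g.divisors, #{x : PeriodicSeq a L | (Necklace.mk x).content = k • r} =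
      Nat.multinomial univ (g • r) := by
  classical
  rw [← card_necklace_content_dvd (L := L) (g • r) (by simp [mul_sum]) (Nat.mul_pos hg hr) hL,
    ← card_biUnion]
  · congr 1
    ext x
    simp only [mem_biUnion, Nat.mem_divisors, mem_filter_univ]
    constructor
    · rintro ⟨k, ⟨⟨d, rfl⟩, -⟩, hk⟩
      exact ⟨d, by rw [hk, smul_smul, mul_comm]⟩
    · rintro ⟨d, hd⟩
      have hdvd : d ∣ g := by
        have h1 : d ∣ univ.gcd (g • r) := Finset.dvd_gcd fun c _ => by
          rw [← hd]; exact Dvd.intro _ rfl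
        have h2 : univ.gcd (g • r) = g := by
          change (univ.gcd fun c => g * r c) = g
          rw [Finset.gcd_mul_left, hcop]; simp
        rwa [h2] at h1
      obtain ⟨k, rfl⟩ := hdvd
      have hd0 : d ≠ 0 := fun h => by simp [h] at hg
      refine ⟨k, ⟨dvd_mul_left _ _, hg.ne'⟩, ?_⟩
      rw [mul_smul] at hd
      funext c
      have := congrFun hd c
      simpa [hd0] using this
  · intro k _ l _ hkl
    refine Finset.disjoint_left.2 fun x hx hy => hkl ?_
    rw [mem_filter_univ] at hx hy
    have h := hx.symm.trans hy
    have := congrArg (fun f => ∑ c, f c) h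
    simp only [Pi.smul_apply, smul_eq_mul, ← mul_sum] at this
    exact Nat.eq_of_mul_eq_mul_right hr this

/-- `M(r)` counts the primitive necklaces of content `r`. -/
theorem card_necklace_content_eq_necklaceM (r : Fin a → ℕ) (hr : r ≠ 0) (hL : ∑ c, r c ∣ L) :
    (#{q : Necklace a L | q.content = r} : ℚ) = necklaceM r := by
  obtain ⟨c₀, hc₀⟩ := Function.ne_iff.1 hr
  obtain ⟨s, hs, hcop⟩ := Finset.extract_gcd r ⟨c₀, mem_univ c₀⟩
  obtain ⟨g, hgdef⟩ : ∃ g, g = univ.gcd r := ⟨_, rfl⟩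
  rw [← hgdef] at hs
  obtain rfl : r = g • s := funext fun c => hs c (mem_univ c)
  have hg : 0 < g := Nat.pos_of_ne_zero fun h => hc₀ (by simp [h])
  have hsum : 0 < ∑ c, s c := Nat.pos_of_ne_zero fun h => by
    rw [sum_eq_zero_iff] at h
    exact hc₀ (by simp [h c₀ (mem_univ _)])
  have hgs : ∑ c, (g • s) c = g * ∑ c, s c := by simp [mul_sum]
  rw [hgs] at hL
  -- Inversion runs over the multiples `k • s` of the coprime vector `s`, on a divisor-closed set of
  -- `k` whose words of content `k • s` have length dividing `L`.
  have hmob := (ArithmeticFunction.sum_eq_iff_sum_mul_moebius_eq_on (R := ℚ)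
    (f := fun k => (#{x : PeriodicSeq a L | (Necklace.mk x).content = k • s} : ℚ))
    (g := fun k => (Nat.multinomial univ (k • s) : ℚ))
    {k | k * ∑ c, s c ∣ L} fun k l hkl hl => (Nat.mul_dvd_mul_right hkl _).trans hl).1
    (fun k hk hkL => by
      rw [← sum_divisors_card_mk_content (L := L) s hcop hk hsum hkL]; push_cast; rfl)
    g hg hL
  rw [Nat.sum_divisorsAntidiagonal (fun i j =>
    (ArithmeticFunction.moebius i : ℚ) * (Nat.multinomial univ (j • s) : ℚ)),
    card_mk_content_eq, hgs] at hmob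
  have hne : ((g * ∑ c, s c : ℕ) : ℚ) ≠ 0 := Nat.cast_ne_zero.2 (Nat.mul_pos hg hsum).ne'
  have hdiv : (g * ∑ c, s c).divisors.filter (fun d => ∀ c, d ∣ (g • s) c) = g.divisors := by
    ext d
    simp only [mem_filter, Nat.mem_divisors]
    constructor
    · rintro ⟨-, h⟩
      exact ⟨hgdef ▸ Finset.dvd_gcd fun c _ => h c, hg.ne'⟩
    · rintro ⟨h, -⟩
      exact ⟨⟨h.mul_right _, (Nat.mul_pos hg hsum).ne'⟩, fun c => h.mul_right _⟩
  rw [necklaceM, hgs, hdiv, eq_comm, one_div, inv_mul_eq_iff_eq_mul₀ hne, ← Nat.cast_mul, ← hmob]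
  refine sum_congr rfl fun d hd => ?_
  obtain ⟨k, hk⟩ := (Nat.mem_divisors.1 hd).1
  have hd0 : 0 < d := Nat.pos_of_mem_divisors hd
  congr 1
  have hspec := Nat.multinomial_spec univ (k • s)
  have h1 : ∀ c, (g • s) c / d = (k • s) c := fun c => by
    rw [hk, mul_smul, Pi.smul_apply, smul_eq_mul, Nat.mul_div_cancel_left _ hd0]
  have h2 : g * ∑ c, s c = d * ∑ c, (k • s) c := by
    rw [hk]; simp [mul_sum, mul_assoc]
  rw [h2, Nat.mul_div_cancel_left _ hd0]
  simp_rw [h1]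
  rw [← hspec, hk, Nat.mul_div_cancel_left _ hd0, Nat.cast_mul, Nat.cast_prod,
    mul_div_cancel_left₀]
  exact prod_ne_zero_iff.2 fun c _ => Nat.cast_ne_zero.2 (Nat.factorial_ne_zero _)

end BiasedShuffle

/-! ### Generating functions and the infinite product. -/

namespace BiasedShuffle

open Finset Function

section PowerSeries

open PowerSeries

theorem inverse_one_sub_C_mul_X_pow {R : Type*} [CommRing R] (y : R) {d : ℕ} (hd : 0 < d) :
    Ring.inverse (1 - C y * X ^ d) = PowerSeries.mk fun k => if d ∣ k then y ^ (k / d) else 0 := by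
  have h : (1 - C y * X ^ d) * PowerSeries.mk (fun k => if d ∣ k then y ^ (k / d) else 0) = 1 := by
    ext k
    rw [sub_mul, one_mul, map_sub, mul_assoc, coeff_C_mul, coeff_X_pow_mul', coeff_mk, coeff_one]
    by_cases hk : d ≤ k
    · obtain ⟨j, rfl⟩ := Nat.exists_eq_add_of_le hk
      rw [if_pos hk, Nat.add_sub_cancel_left, coeff_mk, if_neg (by omega : d + j ≠ 0),
        Nat.add_div_left _ hd]
      simp only [Nat.dvd_add_right (dvd_refl d)]
      split_ifs <;> simp [pow_succ']
    · rw [if_neg hk, mul_zero, sub_zero]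
      rcases Nat.eq_zero_or_pos k with rfl | hk0
      · simp
      · rw [if_neg fun h => hk (Nat.le_of_dvd hk0 h), if_neg hk0.ne']
  have hu : IsUnit (1 - C y * X ^ d) := IsUnit.of_mul_eq_one _ h
  have := Ring.inverse_mul_eq_iff_eq_mul (1 - C y * X ^ d) 1 _ hu |>.2 h.symm
  rwa [mul_one] at this

end PowerSeries

variable {a : ℕ} (p : Fin a → ℝ)

theorem cycleFactor_eq {i : ℕ} (hi : 0 < i) (r : Fin a → ℕ) :
    cycleFactor p i r = PowerSeries.mk fun k =>
      if i ∣ k then (MvPolynomial.C (∏ j, p j ^ r j) * MvPolynomial.X i) ^ (k / i) else 0 := by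
  rw [← inverse_one_sub_C_mul_X_pow _ hi, cycleFactor, map_mul, mul_right_comm]

/-- The coefficients of the generating function, as coefficients of a finite product over
necklaces. -/
theorem coeff_cycleGenFun (n : ℕ) :
    PowerSeries.coeff n (cycleGenFun p) = PowerSeries.coeff n
      (∏ q : Necklace a n.factorial, cycleFactor p q.length q.content) := by
  rw [cycleGenFun, PowerSeries.coeff_mk, shuffleExpect_eq_sum_words, PowerSeries.coeff_prod]
  -- A word corresponds to the choice, in each factor, of the power of `u` given by length times
  -- multiplicity.
  refine sum_of_injOn
    (fun w => Finsupp.equivFunOnFinite.symm fun q => q.length * necklaceMult w q) ?_ ?_ ?_ ?_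
  · intro w _ w' _ h
    refine necklaceMult_injective (funext fun q => ?_)
    have := DFunLike.congr_fun h q
    exact Nat.eq_of_mul_eq_mul_left q.length_pos this
  · intro w _
    simp [sum_length_mul_necklaceMult]
  -- A nonzero term has each exponent divisible by the necklace length, so the quotients are
  -- multiplicities realised by a word.
  · intro l hl hnot
    by_contra hne
    rw [prod_eq_zero_iff] at hne
    push Not at hne
    have hdvd : ∀ q : Necklace a n.factorial, q.length ∣ l q := by
      intro q
      by_contra h
      refine hne q (mem_univ q) ?_
      rw [cycleFactor_eq p q.length_pos, PowerSeries.coeff_mk, if_neg h]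
    have hmul : ∀ q : Necklace a n.factorial, q.length * (l q / q.length) = l q :=
      fun q => Nat.mul_div_cancel' (hdvd q)
    obtain ⟨w, hw⟩ := exists_necklaceMult_eq (fun q => l q / q.length)
      (by simp_rw [hmul]; exact (mem_finsuppAntidiag.1 hl).1)
    refine hnot ⟨w, by simp, ?_⟩
    ext q
    simp [hw, hmul]
  · intro w _
    simp_rw [numCycles_inv]
    rw [prod_pow_numCycles_sort, prod_letters_eq_prod_necklaces, MvPolynomial.smul_eq_C_mul,
      map_prod, ← prod_mul_distrib]
    refine prod_congr rfl fun q _ => ?_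
    rw [cycleFactor_eq p q.length_pos, PowerSeries.coeff_mk]
    simp [Nat.mul_div_cancel_left _ q.length_pos, mul_pow]

/-- Regrouping the factors by length and content. -/
theorem prod_necklaces_eq {L : ℕ} [NeZero L] (M : (Fin a → ℕ) → ℕ)
    (hM : ∀ r : Fin a → ℕ, r ≠ 0 → (M r : ℚ) = necklaceM r) {R : Type*} [CommMonoid R]
    (f : ℕ → (Fin a → ℕ) → R) :
    ∏ q : Necklace a L, f q.length q.content =
      ∏ i ∈ L.divisors, ∏ r ∈ piAntidiag (univ : Finset (Fin a)) i, f i r ^ M r := by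
  rw [← prod_fiberwise_of_maps_to (t := L.divisors) (g := Necklace.length)
    (fun q _ => Nat.mem_divisors.2 ⟨q.length_dvd, NeZero.ne L⟩)]
  refine prod_congr rfl fun i hi => ?_
  rw [← prod_fiberwise_of_maps_to (t := piAntidiag (univ : Finset (Fin a)) i)
    (g := Necklace.content) (fun q hq => by simp [Necklace.sum_content, (mem_filter.1 hq).2])]
  refine prod_congr rfl fun r hr => ?_
  have hr : ∑ c, r c = i := by simpa using hr
  have hi0 : i ≠ 0 := (Nat.pos_of_mem_divisors hi).ne'
  have hcard : M r = #{q : Necklace a L | q.content = r} := by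
    have h : (M r : ℚ) = #{q : Necklace a L | q.content = r} := by
      have hr0 : r ≠ 0 := by rintro rfl; exact hi0 (by simpa using hr.symm)
      rw [hM r hr0, card_necklace_content_eq_necklaceM r hr0 (hr ▸ (Nat.mem_divisors.1 hi).1)]
    exact_mod_cast h
  rw [hcard, ← prod_const, filter_filter]
  refine prod_congr ?_ fun q hq => ?_
  · ext q
    simp only [mem_filter_univ, and_iff_right_iff_imp]
    rintro rfl
    rw [← hr, Necklace.sum_content]
  · obtain ⟨-, h⟩ := mem_filter.1 hq
    rw [h, ← hr, ← h, Necklace.sum_content]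

/-- Only the factors of index at most `n` contribute to the coefficient of `u ^ n`. -/
theorem coeff_prod_cycleFactor (M : (Fin a → ℕ) → ℕ) (n : ℕ) {s : Finset ℕ} (h0 : 0 ∉ s)
    (hs : Icc 1 n ⊆ s) :
    PowerSeries.coeff n
        (∏ i ∈ s, ∏ r ∈ piAntidiag (univ : Finset (Fin a)) i, cycleFactor p i r ^ M r) =
      PowerSeries.coeff n
        (∏ i ∈ Icc 1 n, ∏ r ∈ piAntidiag (univ : Finset (Fin a)) i, cycleFactor p i r ^ M r) := by
  -- Modulo `u ^ (n + 1)` every factor of index above `n` becomes `1`.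
  let φ := Ideal.Quotient.mk
    (Ideal.span {(PowerSeries.X : PowerSeries (MvPolynomial ℕ ℝ)) ^ (n + 1)})
  have hφ : ∀ F G, φ F = φ G → PowerSeries.coeff n F = PowerSeries.coeff n G := by
    intro F G h
    rw [Ideal.Quotient.eq, Ideal.mem_span_singleton, PowerSeries.X_pow_dvd_iff] at h
    have := h n (by omega)
    rwa [map_sub, sub_eq_zero] at this
  refine hφ _ _ ?_
  rw [map_prod, map_prod]
  refine (prod_subset hs fun i hi hin => ?_).symm
  have hi0 : 0 < i := Nat.pos_of_ne_zero fun h => h0 (h ▸ hi)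
  have hn : n < i := by
    by_contra h
    exact hin (mem_Icc.2 ⟨hi0, not_lt.1 h⟩)
  rw [map_prod]
  refine prod_eq_one fun r _ => ?_
  have : φ (cycleFactor p i r) = φ 1 := by
    rw [Ideal.Quotient.eq, Ideal.mem_span_singleton, PowerSeries.X_pow_dvd_iff]
    intro k hk
    rw [map_sub, cycleFactor_eq p hi0, PowerSeries.coeff_mk, PowerSeries.coeff_one]
    rcases Nat.eq_zero_or_pos k with rfl | hk0
    · simp
    · rw [if_neg fun h => by have := Nat.le_of_dvd hk0 h; omega, if_neg hk0.ne', sub_zero]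
  rw [map_pow, this, map_one, one_pow]

end BiasedShuffle

/-- The infinite product is taken in the formal sense: the topology on power series in `u` is that
of coefficientwise convergence, with the coefficient ring `ℝ[x_1, x_2, …]` discrete. -/
theorem theorem5 (a : ℕ) (p : Fin a → ℝ) (hp : ∀ j, 0 ≤ p j) (hsum : ∑ j, p j = 1) :
    ∃ M : (Fin a → ℕ) → ℕ,
      (∀ r : Fin a → ℕ, r ≠ 0 → (M r : ℚ) = BiasedShuffle.necklaceM r) ∧
      letI : TopologicalSpace (MvPolynomial ℕ ℝ) := ⊥
      HasProd
        (fun i : ℕ+ => ∏ r ∈ Finset.piAntidiag (Finset.univ : Finset (Fin a)) (i : ℕ),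
          BiasedShuffle.cycleFactor p i r ^ M r)
        (BiasedShuffle.cycleGenFun p) := by
  -- `M` must not depend on `n`, so necklaces of content `r` are counted with period `(∑ r)!`, a
  -- multiple of `∑ r`.
  have hM : ∀ r : Fin a → ℕ, r ≠ 0 →
      ((Finset.card {q : BiasedShuffle.Necklace a (∑ c, r c).factorial | q.content = r} : ℕ) : ℚ) =
        BiasedShuffle.necklaceM r := by
    intro r hr
    refine BiasedShuffle.card_necklace_content_eq_necklaceM r hr (Nat.dvd_factorial ?_ le_rfl)
    refine Nat.pos_of_ne_zero fun h => hr (funext fun c => ?_)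
    exact Finset.sum_eq_zero_iff.1 h c (Finset.mem_univ c)
  refine ⟨_, hM, ?_⟩
  let : TopologicalSpace (MvPolynomial ℕ ℝ) := ⊥
  rw [HasProd, PowerSeries.WithPiTopology.tendsto_iff_coeff_tendsto]
  intro n
  rw [SummationFilter.unconditional_filter]
  refine tendsto_const_nhds.congr' ?_
  -- The bound `n + 1` is positive even for `n = 0`. The products over the divisors of `n!` and over
  -- `s` both reduce to the one over `Icc 1 n`.
  filter_upwards [Filter.eventually_ge_atTop (Finset.Icc 1 n.succPNat)] with s hs
  rw [BiasedShuffle.coeff_cycleGenFun, BiasedShuffle.prod_necklaces_eq _ hM,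
    BiasedShuffle.coeff_prod_cycleFactor p _ n (by simp), eq_comm]
  · have := BiasedShuffle.coeff_prod_cycleFactor p
      (fun r => Finset.card {q : BiasedShuffle.Necklace a (∑ c, r c).factorial | q.content = r}) n
      (s := s.map ⟨PNat.val, PNat.coe_injective⟩) (by simp) (fun i hi => by
        obtain ⟨h1, h2⟩ := Finset.mem_Icc.1 hi
        refine Finset.mem_map.2 ⟨⟨i, h1⟩, hs (Finset.mem_Icc.2 ⟨one_le, ?_⟩), rfl⟩
        exact PNat.coe_le_coe _ _ |>.1 (h2.trans n.le_succ))
    rwa [Finset.prod_map] at this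
  · intro i hi
    obtain ⟨h1, h2⟩ := Finset.mem_Icc.1 hi
    exact Nat.mem_divisors.2 ⟨Nat.dvd_factorial h1 h2, n.factorial_ne_zero⟩
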